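/- An \emph{unbounded distributive bilattice} is a non-empty set $A$ with binary operations $\vee_t,\wedge_t,\vee_k,\wedge_k$ and a unary operation $\neg$ such that $A_t=(A;\vee_t,\wedge_t)$ and $A_k=(A;\vee_k,\wedge_k)$ are lattices, each of the four binary operations distributes over each of the other three, and $\neg$ is an involution which is a dual endomorphism of $A_t$ and an endomorphism of $A_k$. Let $\mathbf{DB}_u$ be the category of these algebras with all homomorphisms, $\mathbf{D}_u$ the category of non-empty distributive lattices (bounds are not part of the structure) with all lattice homomorphisms, and $\mathcal P_{01}$ the category of doubly-pointed Priestley spaces: compact Priestley spaces with a least element $0$ and a greatest element $1$, $0\neq 1$, with the continuous order-preserving maps that preserve $0$ and $1$ as morphisms. Let $\mathbf 2$ be the two-element lattice, and $\underset{\sim}{\mathbf 2}$ the two-element chain $0<1$ as a discrete object of $\mathcal P_{01}$. Let $\mathbf 4$ be the bilattice on $\{00,01,10,11\}$ whose truth order is the coordinatewise order of binary strings, whose knowledge order has bottom $01$, top $10$ and the incomparable elements $00,11$ in between, and whose negation swaps $00$ and $11$ and fixes $01$ and $10$. Let $\underset{\sim}{\mathbf 4}$ be the same set with the knowledge order $\le_k$,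 distinguished points $01$ and $10$, and the discrete topology. Consider the contravariant hom-functors $$H_u=\mathbf D_u(-,\mathbf 2):\mathbf D_u\to\mathcal P_{01},\quad K_u=\mathcal P_{01}(-,\underset{\sim}{\mathbf 2}):\mathcal P_{01}\to\mathbf D_u,\quad D_u=\mathbf{DB}_u(-,\mathbf 4):\mathbf{DB}_u\to\mathcal P_{01},\quad E_u=\mathcal P_{01}(-,\underset{\sim}{\mathbf 4}):\mathcal P_{01}\to\mathbf{DB}_u,$$ which act on morphisms by composition; here $H_u(L)$ and $D_u(A)$ carry the pointwise order, the constant maps onto the distinguished points, and the topology of pointwise convergence, and $K_u(X)$ and $E_u(X)$ carry the pointwise operations. For $A\in\mathbf{DB}_u$ let $\theta_A=\{(a,b)\in A^2 : a\wedge_t b=a\vee_k b\}$, a congruence of $A_t$. Let $V_u:\mathbf{DB}_u\to\mathbf D_u$ be the functor $V_u(A)=A_t/\theta_A$, $V_u(h)([a]_{\theta_A})=[h(a)]_{\theta_B}$ for $h:A\to B$. Let $W_u:\mathbf D_u\to\mathbf{DB}_u$ be the functor $W_u(L)=L\odot L$, $W_u(g)(a,b)=(g(a),g(b))$, where $L\odot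 L$ is the bilattice on $L\times L$ with $(L\odot L)_t=L\times L^{\partial}$ ($L^\partial$ being the order dual of $L$), $(L\odot L)_k=L\times L$ and $\neg(a,b)=(b,a)$. Then $V_u$ is naturally isomorphic to $K_uD_u$, and $W_u$ is naturally isomorphic to $E_uH_u$. Moreover, for every $A\in\mathbf{DB}_u$ we have $A\cong L\odot L$ for $L=A_t/\theta_A$, and every $L\in\mathbf D_u$ with $A\cong L\odot L$ is isomorphic to $A_t/\theta_A$. -/

import Mathlib

open CategoryTheory Opposite

universe u v w

noncomputable section

/-! ## Unbounded distributive (pre-)bilattices -/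

/-- An unbounded distributive pre-bilattice: two lattice structures on the same set (the truth
lattice and the knowledge lattice) such that each of the four operations distributes over each of
the other three. As all operations are commutative, one-sided distributivity is enough. -/
class DistPreBilattice (A : Type u) where
  tsup : A → A → A
  tinf : A → A → A
  ksup : A → A → A
  kinf : A → A → A
  tsup_comm : ∀ a b, tsup a b = tsup b a
  tsup_assoc : ∀ a b c, tsup (tsup a b) c = tsup a (tsup b c)
  tinf_comm : ∀ a b, tinf a b = tinf b a
  tinf_assoc : ∀ a b c, tinf (tinf a b) c = tinf a (tinf b c)
  tsup_tinf_self : ∀ a b, tsup a (tinf a b) = a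
  tinf_tsup_self : ∀ a b, tinf a (tsup a b) = a
  ksup_comm : ∀ a b, ksup a b = ksup b a
  ksup_assoc : ∀ a b c, ksup (ksup a b) c = ksup a (ksup b c)
  kinf_comm : ∀ a b, kinf a b = kinf b a
  kinf_assoc : ∀ a b c, kinf (kinf a b) c = kinf a (kinf b c)
  ksup_kinf_self : ∀ a b, ksup a (kinf a b) = a
  kinf_ksup_self : ∀ a b, kinf a (ksup a b) = a
  tsup_tinf : ∀ a b c, tsup a (tinf b c) = tinf (tsup a b) (tsup a c)
  tsup_ksup : ∀ a b c, tsup a (ksup b c) = ksup (tsup a b) (tsup a c)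
  tsup_kinf : ∀ a b c, tsup a (kinf b c) = kinf (tsup a b) (tsup a c)
  tinf_tsup : ∀ a b c, tinf a (tsup b c) = tsup (tinf a b) (tinf a c)
  tinf_ksup : ∀ a b c, tinf a (ksup b c) = ksup (tinf a b) (tinf a c)
  tinf_kinf : ∀ a b c, tinf a (kinf b c) = kinf (tinf a b) (tinf a c)
  ksup_tsup : ∀ a b c, ksup a (tsup b c) = tsup (ksup a b) (ksup a c)
  ksup_tinf : ∀ a b c, ksup a (tinf b c) = tinf (ksup a b) (ksup a c)
  ksup_kinf : ∀ a b c, ksup a (kinf b c) = kinf (ksup a b) (ksup a c)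
  kinf_tsup : ∀ a b c, kinf a (tsup b c) = tsup (kinf a b) (kinf a c)
  kinf_tinf : ∀ a b c, kinf a (tinf b c) = tinf (kinf a b) (kinf a c)
  kinf_ksup : ∀ a b c, kinf a (ksup b c) = ksup (kinf a b) (kinf a c)

infixl:68 " ⊔ₜ " => DistPreBilattice.tsup
infixl:69 " ⊓ₜ " => DistPreBilattice.tinf
infixl:68 " ⊔ₖ " => DistPreBilattice.ksup
infixl:69 " ⊓ₖ " => DistPreBilattice.kinf

/-- An unbounded distributive bilattice: a pre-bilattice with an involution `neg` that is a dual
endomorphism of the truth lattice and an endomorphism of the knowledge lattice. -/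
class DistBilattice (A : Type u) extends DistPreBilattice A where
  neg : A → A
  neg_neg : ∀ a, neg (neg a) = a
  neg_tsup : ∀ a b, neg (a ⊔ₜ b) = neg a ⊓ₜ neg b
  neg_tinf : ∀ a b, neg (a ⊓ₜ b) = neg a ⊔ₜ neg b
  neg_ksup : ∀ a b, neg (a ⊔ₖ b) = neg a ⊔ₖ neg b
  neg_kinf : ∀ a b, neg (a ⊓ₖ b) = neg a ⊓ₖ neg b

/-- Homomorphisms of unbounded distributive bilattices. -/
@[ext]
structure BilatHom (A : Type u) (B : Type v) [DistBilattice A] [DistBilattice B] where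
  toFun : A → B
  map_tsup : ∀ a b, toFun (a ⊔ₜ b) = toFun a ⊔ₜ toFun b
  map_tinf : ∀ a b, toFun (a ⊓ₜ b) = toFun a ⊓ₜ toFun b
  map_ksup : ∀ a b, toFun (a ⊔ₖ b) = toFun a ⊔ₖ toFun b
  map_kinf : ∀ a b, toFun (a ⊓ₖ b) = toFun a ⊓ₖ toFun b
  map_neg : ∀ a, toFun (DistBilattice.neg a) = DistBilattice.neg (toFun a)

namespace BilatHom

variable {A : Type u} {B : Type v} {C : Type w} [DistBilattice A] [DistBilattice B]
  [DistBilattice C]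

instance : FunLike (BilatHom A B) A B where
  coe := toFun
  coe_injective _ _ h := BilatHom.ext h

/-- The identity homomorphism. -/
def id (A : Type u) [DistBilattice A] : BilatHom A A :=
  ⟨fun a => a, fun _ _ => rfl, fun _ _ => rfl, fun _ _ => rfl, fun _ _ => rfl, fun _ => rfl⟩

/-- Composition of homomorphisms. -/
def comp (g : BilatHom B C) (f : BilatHom A B) : BilatHom A C where
  toFun a := g.toFun (f.toFun a)
  map_tsup a b := by rw [f.map_tsup, g.map_tsup]
  map_tinf a b := by rw [f.map_tinf, g.map_tinf]
  map_ksup a b := by rw [f.map_ksup, g.map_ksup]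
  map_kinf a b := by rw [f.map_kinf, g.map_kinf]
  map_neg a := by rw [f.map_neg, g.map_neg]

end BilatHom

/-- The category of (non-empty) unbounded distributive bilattices. -/
structure DBu where
  carrier : Type u
  [str : DistBilattice carrier]
  [nonempty : Nonempty carrier]

attribute [instance] DBu.str DBu.nonempty

instance : CoeSort DBu.{u} (Type u) := ⟨DBu.carrier⟩

instance : Category DBu.{u} where
  Hom A B := BilatHom A B
  id A := BilatHom.id A
  comp f g := g.comp f

/-- The category of (non-empty) unbounded distributive lattices: all lattice homomorphisms between
non-empty distributive lattices. -/
abbrev Du : Type (u + 1) :=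
  ObjectProperty.FullSubcategory (fun L : DistLat.{u} => Nonempty L)

namespace Du

instance (L : Du.{u}) : Nonempty L.obj := L.property

/-- A non-empty distributive lattice as an object. -/
abbrev of (L : Type u) [DistribLattice L] [Nonempty L] : Du.{u} := ⟨DistLat.of L, ‹Nonempty L›⟩

/-- The lattice homomorphism underlying a morphism. -/
abbrev homOf {L M : Du.{u}} (f : L ⟶ M) : LatticeHom L.obj M.obj := f.hom.hom

/-- A lattice homomorphism as a morphism. -/
abbrev ofHom {L M : Type u} [DistribLattice L] [Nonempty L] [DistribLattice M] [Nonempty M]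
    (f : LatticeHom L M) : of L ⟶ of M := ObjectProperty.homMk (DistLat.ofHom f)

end Du

/-! ## Doubly-pointed Priestley spaces -/

/-- Morphisms of doubly-pointed Priestley spaces: continuous order-preserving maps which preserve
the two distinguished points, i.e. the bottom and the top. -/
@[ext]
structure P01Hom (X : Type u) (Y : Type v) [TopologicalSpace X] [PartialOrder X] [BoundedOrder X]
    [TopologicalSpace Y] [PartialOrder Y] [BoundedOrder Y] extends BoundedOrderHom X Y where
  continuous_toFun : Continuous toFun

namespace P01Hom

variable {X : Type u} {Y : Type v} {Z : Type w}
  [TopologicalSpace X] [PartialOrder X] [BoundedOrder X]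
  [TopologicalSpace Y] [PartialOrder Y] [BoundedOrder Y]
  [TopologicalSpace Z] [PartialOrder Z] [BoundedOrder Z]

instance : FunLike (P01Hom X Y) X Y where
  coe f := f.toFun
  coe_injective _ _ h := P01Hom.ext h

/-- The identity morphism. -/
def id (X : Type u) [TopologicalSpace X] [PartialOrder X] [BoundedOrder X] : P01Hom X X :=
  ⟨BoundedOrderHom.id X, continuous_id⟩

/-- Composition of morphisms. -/
def comp (g : P01Hom Y Z) (f : P01Hom X Y) : P01Hom X Z :=
  ⟨g.toBoundedOrderHom.comp f.toBoundedOrderHom, g.continuous_toFun.comp f.continuous_toFun⟩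

end P01Hom

/-- The category of doubly-pointed Priestley spaces: compact Priestley spaces with a least and a
greatest element, the two being distinct (`Nontrivial`), and both being part of the structure.
These are, up to isomorphism, the closed substructures of the non-empty powers of the discrete
two-element chain with its bounds as constants. -/
structure P01 where
  carrier : Type u
  [top : TopologicalSpace carrier]
  [order : PartialOrder carrier]
  [bounds : BoundedOrder carrier]
  [compact : CompactSpace carrier]
  [priestley : PriestleySpace carrier]
  [nontrivial : Nontrivial carrier]

attribute [instance] P01.top P01.order P01.bounds P01.compact P01.priestley P01.nontrivial

instance : CoeSort P01.{u} (Type u) := ⟨P01.carrier⟩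

instance : Category P01.{u} where
  Hom X Y := P01Hom X Y
  id X := P01Hom.id X
  comp f g := g.comp f

/-! ## The duality for unbounded distributive lattices

`Bool`, with `false < true` and the discrete topology, is both the two-element lattice and its
alter ego. -/

section DualityDu

variable (L : Type u) [DistribLattice L]

instance instHTop : TopologicalSpace (LatticeHom L Bool) :=
  TopologicalSpace.induced (fun f : LatticeHom L Bool => (f : L → Bool)) inferInstance

instance instHOrder : PartialOrder (LatticeHom L Bool) :=
  PartialOrder.lift (fun f : LatticeHom L Bool => (f : L → Bool)) DFunLike.coe_injective

instance instHBounds : BoundedOrder (LatticeHom L Bool) where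
  bot := ⟨⟨fun _ => false, fun _ _ => rfl⟩, fun _ _ => rfl⟩
  top := ⟨⟨fun _ => true, fun _ _ => rfl⟩, fun _ _ => rfl⟩
  bot_le f := fun a => Bool.false_le (f a)
  le_top f := fun a => Bool.le_true (f a)

instance instHCompact : CompactSpace (LatticeHom L Bool) := by
  have hi : Topology.IsInducing (fun f : LatticeHom L Bool => (f : L → Bool)) := ⟨rfl⟩
  have hr : Set.range (fun f : LatticeHom L Bool => (f : L → Bool)) =
      ⋂ a, ⋂ b, {f : L → Bool | f (a ⊔ b) = (f a ⊔ f b) ∧ f (a ⊓ b) = (f a ⊓ f b)} := by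
    ext f
    simp only [Set.mem_range, Set.mem_iInter, Set.mem_ofPred_eq]
    constructor
    · rintro ⟨g, rfl⟩ a b
      exact ⟨map_sup g a b, map_inf g a b⟩
    · intro h
      exact ⟨⟨⟨f, fun a b => (h a b).1⟩, fun a b => (h a b).2⟩, rfl⟩
  have hc : IsClosed (Set.range (fun f : LatticeHom L Bool => (f : L → Bool))) := by
    rw [hr]
    have hop : ∀ (op : Bool → Bool → Bool) (a b c : L),
        IsClosed {f : L → Bool | f c = op (f a) (f b)} := fun op a b c => by
      have hcont : Continuous ((fun p : Bool × Bool => op p.1 p.2) ∘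
          fun f : L → Bool => (f a, f b)) :=
        continuous_of_discreteTopology.comp ((continuous_apply a).prodMk (continuous_apply b))
      exact isClosed_eq (continuous_apply _) hcont
    exact isClosed_iInter fun a => isClosed_iInter fun b => (hop _ a b _).and (hop _ a b _)
  rw [← isCompact_univ_iff, hi.isCompact_iff, Set.image_univ]
  exact hc.isCompact

theorem continuous_evalH (a : L) : Continuous (fun f : LatticeHom L Bool => f a) :=
  (continuous_apply a).comp
    (continuous_induced_dom (f := fun f : LatticeHom L Bool => (f : L → Bool)))

instance instHPriestley : PriestleySpace (LatticeHom L Bool) where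
  priestley {x y} h := by
    have h' : ∃ a, ¬ x a ≤ y a := by
      by_contra hn
      push Not at hn
      exact h hn
    obtain ⟨a, ha⟩ := h'
    exact ⟨{z | x a ≤ z a}, (isClopen_discrete {b : Bool | x a ≤ b}).preimage
      (continuous_evalH L a), fun z w hzw hz => le_trans hz (hzw a), le_refl (x a), ha⟩

instance instHNontrivial [Nonempty L] : Nontrivial (LatticeHom L Bool) := by
  obtain ⟨a⟩ := ‹Nonempty L›
  exact ⟨⊥, ⊤, fun h => Bool.noConfusion (DFunLike.congr_fun h a : false = true)⟩

end DualityDu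

/-- The hom-functor into the two-element lattice, from non-empty distributive lattices to
doubly-pointed Priestley spaces: the dual `Du(L, 2)` has the pointwise order, the constant maps as
distinguished points and the subspace topology from the product `2 ^ L`. -/
def Hu : Du.{u}ᵒᵖ ⥤ P01.{u} where
  obj L := { carrier := LatticeHom L.unop.obj Bool }
  map {L M} g :=
    { toFun := fun x => x.comp (Du.homOf g.unop)
      monotone' := fun _ _ h a => h (Du.homOf g.unop a)
      map_top' := rfl
      map_bot' := rfl
      continuous_toFun := continuous_induced_rng.2
        (continuous_pi fun a => continuous_evalH L.unop.obj (Du.homOf g.unop a)) }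

section DualityK

variable (X : Type u) [TopologicalSpace X] [PartialOrder X] [BoundedOrder X]

/-- Pointwise application of a binary operation on `Bool` to morphisms into the two-element
doubly-pointed Priestley space. -/
def P01Hom.map₂Bool {X : Type u} [TopologicalSpace X] [PartialOrder X] [BoundedOrder X]
    (op : Bool → Bool → Bool) (hop : ∀ a b c d, a ≤ b → c ≤ d → op a c ≤ op b d)
    (h0 : op false false = false) (h1 : op true true = true) (f g : P01Hom X Bool) :
    P01Hom X Bool where
  toFun x := op (f x) (g x)
  monotone' _ _ h := hop _ _ _ _ (f.monotone' h) (g.monotone' h)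
  map_top' := (congrArg₂ op f.map_top' g.map_top').trans h1
  map_bot' := (congrArg₂ op f.map_bot' g.map_bot').trans h0
  continuous_toFun := (continuous_of_discreteTopology
    (f := fun p : Bool × Bool => op p.1 p.2)).comp (f.continuous_toFun.prodMk g.continuous_toFun)

instance instKMax : Max (P01Hom X Bool) :=
  ⟨P01Hom.map₂Bool (· ⊔ ·) (fun _ _ _ _ h k => sup_le_sup h k) rfl rfl⟩

instance instKMin : Min (P01Hom X Bool) :=
  ⟨P01Hom.map₂Bool (· ⊓ ·) (fun _ _ _ _ h k => inf_le_inf h k) rfl rfl⟩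

instance instKLE : LE (P01Hom X Bool) := ⟨fun f g => (f : X → Bool) ≤ g⟩

instance instKLT : LT (P01Hom X Bool) := ⟨fun f g => (f : X → Bool) < g⟩

/-- Pointwise lattice operations on the morphisms into the two-element space. -/
instance instKLattice : DistribLattice (P01Hom X Bool) :=
  Function.Injective.distribLattice (fun f : P01Hom X Bool => (f : X → Bool))
    DFunLike.coe_injective Iff.rfl Iff.rfl (fun _ _ => rfl) (fun _ _ => rfl)

end DualityK

section DualityKNonempty

variable (X : Type u) [TopologicalSpace X] [PartialOrder X] [BoundedOrder X]
  [PriestleySpace X] [Nontrivial X]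

instance instKNonempty : Nonempty (P01Hom X Bool) := by
  classical
  have hne : ¬ (⊤ : X) ≤ ⊥ := fun h => bot_ne_top (le_antisymm bot_le h)
  obtain ⟨U, hU, hup, ht, hb⟩ := exists_isClopen_upper_of_not_le hne
  exact ⟨{
    toFun := fun x => decide (x ∈ U)
    monotone' := fun x y h => by
      intro hx
      have : x ∈ U := by simpa using hx
      simpa using hup h this
    map_top' := by simpa using ht
    map_bot' := by
      have : ⊥ ∉ U := hb
      simpa using this
    continuous_toFun := by
      rw [continuous_discrete_rng]
      rintro (_ | _)
      · have : (fun x => decide (x ∈ U)) ⁻¹' {false} = Uᶜ := by ext; simp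
        rw [this]
        exact hU.compl.isOpen
      · have : (fun x => decide (x ∈ U)) ⁻¹' {true} = U := by ext; simp
        rw [this]
        exact hU.isOpen }⟩

end DualityKNonempty

/-- The hom-functor into the two-element doubly-pointed Priestley space, with pointwise lattice
operations. -/
def Ku : P01.{u}ᵒᵖ ⥤ Du.{u} where
  obj X := Du.of (P01Hom X.unop Bool)
  map {X Y} φ := Du.ofHom
    { toFun := fun f => f.comp (φ.unop : P01Hom Y.unop X.unop)
      map_sup' := fun _ _ => rfl
      map_inf' := fun _ _ => rfl }

/-! ## The four-element bilattice -/

/-- The four-element set of binary strings `ij`. -/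
@[ext]
structure Four where
  i : Bool
  j : Bool

namespace Four

/-- The truth order is the product order on strings, with bottom `00` and top `11`; the knowledge
order has bottom `01` and top `10`; negation swaps `00` and `11` and fixes `01` and `10`. -/
instance : DistBilattice Four where
  tsup a b := ⟨a.i || b.i, a.j || b.j⟩
  tinf a b := ⟨a.i && b.i, a.j && b.j⟩
  ksup a b := ⟨a.i || b.i, a.j && b.j⟩
  kinf a b := ⟨a.i && b.i, a.j || b.j⟩
  neg a := ⟨!a.j, !a.i⟩
  tsup_comm := by rintro ⟨_ | _, _ | _⟩ ⟨_ | _, _ | _⟩ <;> rfl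
  tsup_assoc := by rintro ⟨_ | _, _ | _⟩ ⟨_ | _, _ | _⟩ ⟨_ | _, _ | _⟩ <;> rfl
  tinf_comm := by rintro ⟨_ | _, _ | _⟩ ⟨_ | _, _ | _⟩ <;> rfl
  tinf_assoc := by rintro ⟨_ | _, _ | _⟩ ⟨_ | _, _ | _⟩ ⟨_ | _, _ | _⟩ <;> rfl
  tsup_tinf_self := by rintro ⟨_ | _, _ | _⟩ ⟨_ | _, _ | _⟩ <;> rfl
  tinf_tsup_self := by rintro ⟨_ | _, _ | _⟩ ⟨_ | _, _ | _⟩ <;> rfl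
  ksup_comm := by rintro ⟨_ | _, _ | _⟩ ⟨_ | _, _ | _⟩ <;> rfl
  ksup_assoc := by rintro ⟨_ | _, _ | _⟩ ⟨_ | _, _ | _⟩ ⟨_ | _, _ | _⟩ <;> rfl
  kinf_comm := by rintro ⟨_ | _, _ | _⟩ ⟨_ | _, _ | _⟩ <;> rfl
  kinf_assoc := by rintro ⟨_ | _, _ | _⟩ ⟨_ | _, _ | _⟩ ⟨_ | _, _ | _⟩ <;> rfl
  ksup_kinf_self := by rintro ⟨_ | _, _ | _⟩ ⟨_ | _, _ | _⟩ <;> rfl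
  kinf_ksup_self := by rintro ⟨_ | _, _ | _⟩ ⟨_ | _, _ | _⟩ <;> rfl
  tsup_tinf := by rintro ⟨_ | _, _ | _⟩ ⟨_ | _, _ | _⟩ ⟨_ | _, _ | _⟩ <;> rfl
  tsup_ksup := by rintro ⟨_ | _, _ | _⟩ ⟨_ | _, _ | _⟩ ⟨_ | _, _ | _⟩ <;> rfl
  tsup_kinf := by rintro ⟨_ | _, _ | _⟩ ⟨_ | _, _ | _⟩ ⟨_ | _, _ | _⟩ <;> rfl
  tinf_tsup := by rintro ⟨_ | _, _ | _⟩ ⟨_ | _, _ | _⟩ ⟨_ | _, _ | _⟩ <;> rfl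
  tinf_ksup := by rintro ⟨_ | _, _ | _⟩ ⟨_ | _, _ | _⟩ ⟨_ | _, _ | _⟩ <;> rfl
  tinf_kinf := by rintro ⟨_ | _, _ | _⟩ ⟨_ | _, _ | _⟩ ⟨_ | _, _ | _⟩ <;> rfl
  ksup_tsup := by rintro ⟨_ | _, _ | _⟩ ⟨_ | _, _ | _⟩ ⟨_ | _, _ | _⟩ <;> rfl
  ksup_tinf := by rintro ⟨_ | _, _ | _⟩ ⟨_ | _, _ | _⟩ ⟨_ | _, _ | _⟩ <;> rfl
  ksup_kinf := by rintro ⟨_ | _, _ | _⟩ ⟨_ | _, _ | _⟩ ⟨_ | _, _ | _⟩ <;> rfl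
  kinf_tsup := by rintro ⟨_ | _, _ | _⟩ ⟨_ | _, _ | _⟩ ⟨_ | _, _ | _⟩ <;> rfl
  kinf_tinf := by rintro ⟨_ | _, _ | _⟩ ⟨_ | _, _ | _⟩ ⟨_ | _, _ | _⟩ <;> rfl
  kinf_ksup := by rintro ⟨_ | _, _ | _⟩ ⟨_ | _, _ | _⟩ ⟨_ | _, _ | _⟩ <;> rfl
  neg_neg := by rintro ⟨_ | _, _ | _⟩ <;> rfl
  neg_tsup := by rintro ⟨_ | _, _ | _⟩ ⟨_ | _, _ | _⟩ <;> rfl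
  neg_tinf := by rintro ⟨_ | _, _ | _⟩ ⟨_ | _, _ | _⟩ <;> rfl
  neg_ksup := by rintro ⟨_ | _, _ | _⟩ ⟨_ | _, _ | _⟩ <;> rfl
  neg_kinf := by rintro ⟨_ | _, _ | _⟩ ⟨_ | _, _ | _⟩ <;> rfl

/-- The order of the alter ego is the knowledge order: `a ≤ₖ b` iff `a ⊓ₖ b = a`. -/
instance : PartialOrder Four where
  le a b := a ⊓ₖ b = a
  le_refl := by rintro ⟨_ | _, _ | _⟩ <;> rfl
  le_trans a b c h k := by
    have h' : a ⊓ₖ b = a := h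
    have k' : b ⊓ₖ c = b := k
    change a ⊓ₖ c = a
    rw [← h', DistPreBilattice.kinf_assoc, k']
  le_antisymm a b h k := by
    have h' : a ⊓ₖ b = a := h
    have k' : b ⊓ₖ a = b := k
    rw [← h', DistPreBilattice.kinf_comm, k']

/-- The constants of the alter ego: `01` is the bottom and `10` the top of the knowledge order. -/
instance : BoundedOrder Four where
  bot := ⟨false, true⟩
  top := ⟨true, false⟩
  bot_le := by rintro ⟨_ | _, _ | _⟩ <;> rfl
  le_top := by rintro ⟨_ | _, _ | _⟩ <;> rfl

instance : TopologicalSpace Four := ⊥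

instance : DiscreteTopology Four := ⟨rfl⟩

instance : Finite Four :=
  Finite.of_injective (fun a : Four => (a.i, a.j)) fun a b h => by
    obtain ⟨h1, h2⟩ := Prod.ext_iff.1 h
    exact Four.ext h1 h2

end Four

/-! ## The natural duality for unbounded distributive bilattices -/

section DualityDBu

variable (A : Type u) [DistBilattice A]

instance instDTop : TopologicalSpace (BilatHom A Four) :=
  TopologicalSpace.induced (fun f : BilatHom A Four => (f : A → Four)) inferInstance

instance instDOrder : PartialOrder (BilatHom A Four) :=
  PartialOrder.lift (fun f : BilatHom A Four => (f : A → Four)) DFunLike.coe_injective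

instance instDBounds : BoundedOrder (BilatHom A Four) where
  bot := ⟨fun _ => ⊥, fun _ _ => rfl, fun _ _ => rfl, fun _ _ => rfl, fun _ _ => rfl, fun _ => rfl⟩
  top := ⟨fun _ => ⊤, fun _ _ => rfl, fun _ _ => rfl, fun _ _ => rfl, fun _ _ => rfl, fun _ => rfl⟩
  bot_le f := fun a => bot_le (a := f a)
  le_top f := fun a => le_top (a := f a)

instance instDCompact : CompactSpace (BilatHom A Four) := by
  have hi : Topology.IsInducing (fun f : BilatHom A Four => (f : A → Four)) := ⟨rfl⟩
  have hr : Set.range (fun f : BilatHom A Four => (f : A → Four)) =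
      (⋂ a, ⋂ b, {f : A → Four | f (a ⊔ₜ b) = (f a ⊔ₜ f b) ∧ f (a ⊓ₜ b) = (f a ⊓ₜ f b) ∧
        f (a ⊔ₖ b) = (f a ⊔ₖ f b) ∧ f (a ⊓ₖ b) = (f a ⊓ₖ f b)}) ∩
      ⋂ a, {f : A → Four | f (DistBilattice.neg a) = DistBilattice.neg (f a)} := by
    ext f
    simp only [Set.mem_range, Set.mem_inter_iff, Set.mem_iInter, Set.mem_ofPred_eq]
    constructor
    · rintro ⟨g, rfl⟩
      exact ⟨fun a b => ⟨g.map_tsup a b, g.map_tinf a b, g.map_ksup a b, g.map_kinf a b⟩,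
        g.map_neg⟩
    · rintro ⟨h, hn⟩
      exact ⟨⟨f, fun a b => (h a b).1, fun a b => (h a b).2.1, fun a b => (h a b).2.2.1,
        fun a b => (h a b).2.2.2, hn⟩, rfl⟩
  have hop : ∀ (op : Four → Four → Four) (a b c : A),
      IsClosed {f : A → Four | f c = op (f a) (f b)} := fun op a b c => by
    have hcont : Continuous ((fun p : Four × Four => op p.1 p.2) ∘
        fun f : A → Four => (f a, f b)) :=
      continuous_of_discreteTopology.comp ((continuous_apply a).prodMk (continuous_apply b))
    exact isClosed_eq (continuous_apply _) hcont
  have hc : IsClosed (Set.range (fun f : BilatHom A Four => (f : A → Four))) := by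
    rw [hr]
    refine IsClosed.inter (isClosed_iInter fun a => isClosed_iInter fun b => ?_)
      (isClosed_iInter fun a => hop (fun p _ => DistBilattice.neg p) a a _)
    exact (hop _ a b _).and ((hop _ a b _).and ((hop _ a b _).and (hop _ a b _)))
  rw [← isCompact_univ_iff, hi.isCompact_iff, Set.image_univ]
  exact hc.isCompact

theorem continuous_evalD (a : A) : Continuous (fun f : BilatHom A Four => f a) :=
  (continuous_apply a).comp
    (continuous_induced_dom (f := fun f : BilatHom A Four => (f : A → Four)))

instance instDPriestley : PriestleySpace (BilatHom A Four) where
  priestley {x y} h := by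
    have h' : ∃ a, ¬ x a ≤ y a := by
      by_contra hn
      push Not at hn
      exact h hn
    obtain ⟨a, ha⟩ := h'
    exact ⟨{z | x a ≤ z a}, (isClopen_discrete {b : Four | x a ≤ b}).preimage
      (continuous_evalD A a), fun z w hzw hz => le_trans hz (hzw a), le_refl (x a), ha⟩

instance instDNontrivial [Nonempty A] : Nontrivial (BilatHom A Four) := by
  obtain ⟨a⟩ := ‹Nonempty A›
  exact ⟨⊥, ⊤, fun h => Bool.noConfusion
    (congrArg Four.i (DFunLike.congr_fun h a : (⊥ : Four) = ⊤) : false = true)⟩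

end DualityDBu

/-- The hom-functor into the four-element bilattice: the natural dual `DBu(A, 4)` is ordered
pointwise by the knowledge order, has the constant maps to `01` and `10` as distinguished points,
and carries the subspace topology from the product `4 ^ A`. -/
def DuDB : DBu.{u}ᵒᵖ ⥤ P01.{u} where
  obj A := { carrier := BilatHom A.unop Four }
  map {A B} h :=
    { toFun := fun x => x.comp h.unop
      monotone' := fun _ _ hxy b => hxy (BilatHom.toFun h.unop b)
      map_top' := rfl
      map_bot' := rfl
      continuous_toFun := continuous_induced_rng.2
        (continuous_pi fun b => continuous_evalD A.unop (BilatHom.toFun h.unop b)) }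

section DualityE

variable (X : Type u) [TopologicalSpace X] [PartialOrder X] [BoundedOrder X]

/-- Pointwise application of a binary operation on `Four` to morphisms into the alter ego. -/
def P01Hom.map₂Four {X : Type u} [TopologicalSpace X] [PartialOrder X] [BoundedOrder X]
    (op : Four → Four → Four) (hop : ∀ a b c d, a ≤ b → c ≤ d → op a c ≤ op b d)
    (h0 : op ⊥ ⊥ = ⊥) (h1 : op ⊤ ⊤ = ⊤) (f g : P01Hom X Four) : P01Hom X Four where
  toFun x := op (f x) (g x)
  monotone' _ _ h := hop _ _ _ _ (f.monotone' h) (g.monotone' h)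
  map_top' := (congrArg₂ op f.map_top' g.map_top').trans h1
  map_bot' := (congrArg₂ op f.map_bot' g.map_bot').trans h0
  continuous_toFun := (continuous_of_discreteTopology
    (f := fun p : Four × Four => op p.1 p.2)).comp (f.continuous_toFun.prodMk g.continuous_toFun)

theorem Four.le_iff {a b : Four} : a ≤ b ↔ a ⊓ₖ b = a := Iff.rfl

theorem Four.tsup_mono (a b c d : Four) (h : a ≤ b) (k : c ≤ d) : a ⊔ₜ c ≤ b ⊔ₜ d := by
  obtain ⟨_ | _, _ | _⟩ := a <;> obtain ⟨_ | _, _ | _⟩ := b <;>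
    obtain ⟨_ | _, _ | _⟩ := c <;> obtain ⟨_ | _, _ | _⟩ := d <;>
    simp [Four.le_iff, DistPreBilattice.kinf, DistPreBilattice.tsup] at *

theorem Four.tinf_mono (a b c d : Four) (h : a ≤ b) (k : c ≤ d) : a ⊓ₜ c ≤ b ⊓ₜ d := by
  obtain ⟨_ | _, _ | _⟩ := a <;> obtain ⟨_ | _, _ | _⟩ := b <;>
    obtain ⟨_ | _, _ | _⟩ := c <;> obtain ⟨_ | _, _ | _⟩ := d <;>
    simp [Four.le_iff, DistPreBilattice.kinf, DistPreBilattice.tinf] at *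

theorem Four.ksup_mono (a b c d : Four) (h : a ≤ b) (k : c ≤ d) : a ⊔ₖ c ≤ b ⊔ₖ d := by
  obtain ⟨_ | _, _ | _⟩ := a <;> obtain ⟨_ | _, _ | _⟩ := b <;>
    obtain ⟨_ | _, _ | _⟩ := c <;> obtain ⟨_ | _, _ | _⟩ := d <;>
    simp [Four.le_iff, DistPreBilattice.kinf, DistPreBilattice.ksup] at *

theorem Four.kinf_mono (a b c d : Four) (h : a ≤ b) (k : c ≤ d) : a ⊓ₖ c ≤ b ⊓ₖ d := by
  obtain ⟨_ | _, _ | _⟩ := a <;> obtain ⟨_ | _, _ | _⟩ := b <;>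
    obtain ⟨_ | _, _ | _⟩ := c <;> obtain ⟨_ | _, _ | _⟩ := d <;>
    simp [Four.le_iff, DistPreBilattice.kinf] at *

theorem Four.neg_mono (a b : Four) (h : a ≤ b) :
    (DistBilattice.neg a : Four) ≤ DistBilattice.neg b := by
  rw [Four.le_iff] at *
  rw [← DistBilattice.neg_kinf, h]

/-- Pointwise bilattice operations on the morphisms into the alter ego. -/
instance instEBilattice : DistBilattice (P01Hom X Four) where
  tsup := P01Hom.map₂Four (· ⊔ₜ ·) Four.tsup_mono rfl rfl
  tinf := P01Hom.map₂Four (· ⊓ₜ ·) Four.tinf_mono rfl rfl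
  ksup := P01Hom.map₂Four (· ⊔ₖ ·) Four.ksup_mono rfl rfl
  kinf := P01Hom.map₂Four (· ⊓ₖ ·) Four.kinf_mono rfl rfl
  neg f := P01Hom.map₂Four (fun p _ => DistBilattice.neg p)
    (fun a b _ _ h _ => Four.neg_mono a b h) rfl rfl f f
  tsup_comm f g := DFunLike.ext _ _ fun x => DistPreBilattice.tsup_comm (f x) (g x)
  tsup_assoc f g h := DFunLike.ext _ _ fun x => DistPreBilattice.tsup_assoc (f x) (g x) (h x)
  tinf_comm f g := DFunLike.ext _ _ fun x => DistPreBilattice.tinf_comm (f x) (g x)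
  tinf_assoc f g h := DFunLike.ext _ _ fun x => DistPreBilattice.tinf_assoc (f x) (g x) (h x)
  tsup_tinf_self f g := DFunLike.ext _ _ fun x => DistPreBilattice.tsup_tinf_self (f x) (g x)
  tinf_tsup_self f g := DFunLike.ext _ _ fun x => DistPreBilattice.tinf_tsup_self (f x) (g x)
  ksup_comm f g := DFunLike.ext _ _ fun x => DistPreBilattice.ksup_comm (f x) (g x)
  ksup_assoc f g h := DFunLike.ext _ _ fun x => DistPreBilattice.ksup_assoc (f x) (g x) (h x)
  kinf_comm f g := DFunLike.ext _ _ fun x => DistPreBilattice.kinf_comm (f x) (g x)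
  kinf_assoc f g h := DFunLike.ext _ _ fun x => DistPreBilattice.kinf_assoc (f x) (g x) (h x)
  ksup_kinf_self f g := DFunLike.ext _ _ fun x => DistPreBilattice.ksup_kinf_self (f x) (g x)
  kinf_ksup_self f g := DFunLike.ext _ _ fun x => DistPreBilattice.kinf_ksup_self (f x) (g x)
  tsup_tinf f g h := DFunLike.ext _ _ fun x => DistPreBilattice.tsup_tinf (f x) (g x) (h x)
  tsup_ksup f g h := DFunLike.ext _ _ fun x => DistPreBilattice.tsup_ksup (f x) (g x) (h x)
  tsup_kinf f g h := DFunLike.ext _ _ fun x => DistPreBilattice.tsup_kinf (f x) (g x) (h x)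
  tinf_tsup f g h := DFunLike.ext _ _ fun x => DistPreBilattice.tinf_tsup (f x) (g x) (h x)
  tinf_ksup f g h := DFunLike.ext _ _ fun x => DistPreBilattice.tinf_ksup (f x) (g x) (h x)
  tinf_kinf f g h := DFunLike.ext _ _ fun x => DistPreBilattice.tinf_kinf (f x) (g x) (h x)
  ksup_tsup f g h := DFunLike.ext _ _ fun x => DistPreBilattice.ksup_tsup (f x) (g x) (h x)
  ksup_tinf f g h := DFunLike.ext _ _ fun x => DistPreBilattice.ksup_tinf (f x) (g x) (h x)
  ksup_kinf f g h := DFunLike.ext _ _ fun x => DistPreBilattice.ksup_kinf (f x) (g x) (h x)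
  kinf_tsup f g h := DFunLike.ext _ _ fun x => DistPreBilattice.kinf_tsup (f x) (g x) (h x)
  kinf_tinf f g h := DFunLike.ext _ _ fun x => DistPreBilattice.kinf_tinf (f x) (g x) (h x)
  kinf_ksup f g h := DFunLike.ext _ _ fun x => DistPreBilattice.kinf_ksup (f x) (g x) (h x)
  neg_neg f := DFunLike.ext _ _ fun x => DistBilattice.neg_neg (f x)
  neg_tsup f g := DFunLike.ext _ _ fun x => DistBilattice.neg_tsup (f x) (g x)
  neg_tinf f g := DFunLike.ext _ _ fun x => DistBilattice.neg_tinf (f x) (g x)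
  neg_ksup f g := DFunLike.ext _ _ fun x => DistBilattice.neg_ksup (f x) (g x)
  neg_kinf f g := DFunLike.ext _ _ fun x => DistBilattice.neg_kinf (f x) (g x)

end DualityE

/-- The embedding `0 ↦ 01`, `1 ↦ 10` of the two-element doubly-pointed space into the alter ego. -/
def P01Hom.boolToFour : P01Hom Bool Four where
  toFun b := ⟨b, !b⟩
  monotone' := by rintro (_ | _) (_ | _) h <;> first | rfl | exact absurd h (by decide)
  map_top' := rfl
  map_bot' := rfl
  continuous_toFun := continuous_of_discreteTopology

instance instENonempty (X : Type u) [TopologicalSpace X] [PartialOrder X] [BoundedOrder X]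
    [PriestleySpace X] [Nontrivial X] : Nonempty (P01Hom X Four) :=
  (instKNonempty X).map fun f => P01Hom.boolToFour.comp f

/-- The hom-functor into the alter ego, with pointwise bilattice operations. -/
def EuDB : P01.{u}ᵒᵖ ⥤ DBu.{u} where
  obj X := { carrier := P01Hom X.unop Four }
  map {X Y} φ :=
    { toFun := fun f => f.comp (φ.unop : P01Hom Y.unop X.unop)
      map_tsup := fun _ _ => rfl
      map_tinf := fun _ _ => rfl
      map_ksup := fun _ _ => rfl
      map_kinf := fun _ _ => rfl
      map_neg := fun _ => rfl }

/-! ## The truth lattice, the congruence and its quotient -/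

/-- The truth lattice reduct `A_t` of `A`. -/
def TruthLattice (A : Type u) : Type u := A

section Truth

variable {A : Type u} [DistBilattice A]

instance : Max (TruthLattice A) := ⟨(DistPreBilattice.tsup : A → A → A)⟩

instance : Min (TruthLattice A) := ⟨(DistPreBilattice.tinf : A → A → A)⟩

instance [Nonempty A] : Nonempty (TruthLattice A) := ‹Nonempty A›

instance instTruthLattice : Lattice (TruthLattice A) :=
  Lattice.mk' (DistPreBilattice.tsup_comm (A := A)) (DistPreBilattice.tsup_assoc (A := A))
    (DistPreBilattice.tinf_comm (A := A)) (DistPreBilattice.tinf_assoc (A := A))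
    (DistPreBilattice.tsup_tinf_self (A := A)) (DistPreBilattice.tinf_tsup_self (A := A))

instance instTruthDistrib : DistribLattice (TruthLattice A) where
  le_sup_inf a b c := le_of_eq (DistPreBilattice.tsup_tinf (A := A) a b c).symm

end Truth

/-- The quotient of a lattice by a congruence, with the induced operations. -/
def LatQuot {L : Type u} [DistribLattice L] (c : LatticeCon L) : Type u := Quotient c.toSetoid

section LatQuot

variable {L : Type u} [DistribLattice L] (c : LatticeCon L)

instance : Max (LatQuot c) := ⟨Quotient.map₂ (· ⊔ ·) fun _ _ h _ _ k => c.sup h k⟩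

instance : Min (LatQuot c) := ⟨Quotient.map₂ (· ⊓ ·) fun _ _ h _ _ k => c.inf h k⟩

instance [Nonempty L] : Nonempty (LatQuot c) := ‹Nonempty L›.map (Quotient.mk c.toSetoid)

instance instQuotLattice : Lattice (LatQuot c) :=
  Lattice.mk'
    (by rintro ⟨a⟩ ⟨b⟩; exact congrArg (Quotient.mk c.toSetoid) (sup_comm a b))
    (by rintro ⟨a⟩ ⟨b⟩ ⟨d⟩; exact congrArg (Quotient.mk c.toSetoid) (sup_assoc a b d))
    (by rintro ⟨a⟩ ⟨b⟩; exact congrArg (Quotient.mk c.toSetoid) (inf_comm a b))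
    (by rintro ⟨a⟩ ⟨b⟩ ⟨d⟩; exact congrArg (Quotient.mk c.toSetoid) (inf_assoc a b d))
    (by rintro ⟨a⟩ ⟨b⟩; exact congrArg (Quotient.mk c.toSetoid) (sup_inf_self (a := a) (b := b)))
    (by rintro ⟨a⟩ ⟨b⟩; exact congrArg (Quotient.mk c.toSetoid) (inf_sup_self (a := a) (b := b)))

instance instQuotDistrib : DistribLattice (LatQuot c) where
  le_sup_inf := by
    rintro ⟨a⟩ ⟨b⟩ ⟨d⟩
    exact le_of_eq (congrArg (Quotient.mk c.toSetoid) (sup_inf_left a b d)).symm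

end LatQuot

section Theta

open DistPreBilattice

variable {A : Type u} [DistBilattice A]

theorem bilat_tsup_self (a : A) : a ⊔ₜ a = a := sup_idem (α := TruthLattice A) a

theorem bilat_tinf_self (a : A) : a ⊓ₜ a = a := inf_idem (α := TruthLattice A) a

theorem bilat_ksup_self (a : A) : a ⊔ₖ a = a := by
  have h := ksup_kinf_self a (a ⊔ₖ a)
  rwa [kinf_ksup_self] at h

/-- `a ⊓ₜ b ≤ₜ a ⊔ₖ b`. -/
theorem bilat_tinf_le_ksup (a b : A) : (a ⊓ₜ b) ⊓ₜ (a ⊔ₖ b) = a ⊓ₜ b := by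
  rw [tinf_ksup, tinf_comm (a ⊓ₜ b) a, ← tinf_assoc, bilat_tinf_self, tinf_assoc,
    bilat_tinf_self, bilat_ksup_self]

/-- If `b` lies between `a` and `c` in the knowledge order, then `b ≤ₜ a ⊔ₜ c`. -/
theorem bilat_between {a b c : A} (hab : a ⊔ₖ b = b) (hbc : b ⊔ₖ c = c) :
    b ⊔ₜ (a ⊔ₜ c) = a ⊔ₜ c := by
  have e1 : (a ⊔ₜ c) ⊔ₖ (b ⊔ₜ (a ⊔ₜ c)) = b ⊔ₜ (a ⊔ₜ c) := by
    have h : (a ⊔ₜ c) ⊔ₜ a = a ⊔ₜ c := by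
      rw [tsup_comm, ← tsup_assoc, bilat_tsup_self]
    calc (a ⊔ₜ c) ⊔ₖ (b ⊔ₜ (a ⊔ₜ c))
        = ((a ⊔ₜ c) ⊔ₜ a) ⊔ₖ ((a ⊔ₜ c) ⊔ₜ b) := by rw [h, tsup_comm b]
      _ = b ⊔ₜ (a ⊔ₜ c) := by rw [← tsup_ksup, hab, tsup_comm]
  have e2 : (b ⊔ₜ (a ⊔ₜ c)) ⊔ₖ (a ⊔ₜ c) = a ⊔ₜ c := by
    have h : (a ⊔ₜ c) ⊔ₜ c = a ⊔ₜ c := by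
      rw [tsup_assoc, bilat_tsup_self]
    calc (b ⊔ₜ (a ⊔ₜ c)) ⊔ₖ (a ⊔ₜ c)
        = ((a ⊔ₜ c) ⊔ₜ b) ⊔ₖ ((a ⊔ₜ c) ⊔ₜ c) := by rw [h, tsup_comm b]
      _ = a ⊔ₜ c := by rw [← tsup_ksup, hbc, h]
  rw [← e1, ksup_comm, e2]

/-- The relation `θ`: `a θ b` iff `a ⊓ₜ b = a ⊔ₖ b`. -/
def ThetaRel (a b : A) : Prop := a ⊓ₜ b = a ⊔ₖ b

theorem thetaRel_symm {a b : A} (h : ThetaRel a b) : ThetaRel b a := by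
  have h' : a ⊓ₜ b = a ⊔ₖ b := h
  change b ⊓ₜ a = b ⊔ₖ a
  rw [tinf_comm, h', ksup_comm]

theorem thetaRel_iff {a b : A} :
    ThetaRel a b ↔ (a ⊔ₖ b) ⊔ₜ a = a ∧ (a ⊔ₖ b) ⊔ₜ b = b := by
  constructor
  · intro h
    rw [← (h : a ⊓ₜ b = a ⊔ₖ b)]
    exact ⟨sup_eq_right.2 (inf_le_left (α := TruthLattice A)),
      sup_eq_right.2 (inf_le_right (α := TruthLattice A))⟩
  · rintro ⟨h1, h2⟩
    refine le_antisymm (α := TruthLattice A) (inf_eq_left.1 (bilat_tinf_le_ksup a b)) ?_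
    exact le_inf (α := TruthLattice A) (sup_eq_right.1 h1) (sup_eq_right.1 h2)

theorem thetaRel_trans {a b c : A} (hab : ThetaRel a b) (hbc : ThetaRel b c) : ThetaRel a c := by
  have key : ∀ {a b c : A}, ThetaRel a b → ThetaRel b c → (a ⊔ₖ c) ⊔ₜ a = a := by
    intro a b c hab hbc
    obtain ⟨h1, -⟩ := thetaRel_iff.1 hab
    obtain ⟨h3, -⟩ := thetaRel_iff.1 hbc
    -- the element `a ⊔ₖ b ⊔ₖ c` is below `a` in the truth order
    have hx : (a ⊔ₖ (b ⊔ₖ c)) ⊔ₜ a = a := by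
      have h4 : (a ⊔ₖ (b ⊔ₖ c)) ⊔ₜ (a ⊔ₖ b) = a ⊔ₖ b := by rw [← ksup_tsup, h3]
      calc (a ⊔ₖ (b ⊔ₖ c)) ⊔ₜ a
          = (a ⊔ₖ (b ⊔ₖ c)) ⊔ₜ ((a ⊔ₖ b) ⊔ₜ a) := by rw [h1]
        _ = a := by rw [← tsup_assoc, h4, h1]
    have hb := bilat_between (a := a) (b := a ⊔ₖ c) (c := a ⊔ₖ (b ⊔ₖ c))
      (by rw [← ksup_assoc, bilat_ksup_self])
      (by
        have : a ⊔ₖ (b ⊔ₖ c) = (a ⊔ₖ c) ⊔ₖ b := by rw [ksup_comm b c, ksup_assoc]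
        rw [this, ← ksup_assoc, bilat_ksup_self])
    rwa [tsup_comm a, hx] at hb
  refine thetaRel_iff.2 ⟨key hab hbc, ?_⟩
  rw [ksup_comm]
  exact key (thetaRel_symm hbc) (thetaRel_symm hab)

theorem thetaRel_tinf {a b : A} (h : ThetaRel a b) (c : A) : ThetaRel (c ⊓ₜ a) (c ⊓ₜ b) := by
  obtain ⟨h1, h2⟩ := thetaRel_iff.1 h
  refine thetaRel_iff.2 ⟨?_, ?_⟩
  · rw [← tinf_ksup, ← tinf_tsup, h1]
  · rw [← tinf_ksup, ← tinf_tsup, h2]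

theorem thetaRel_tsup {a b : A} (h : ThetaRel a b) (c : A) : ThetaRel (c ⊔ₜ a) (c ⊔ₜ b) := by
  obtain ⟨h1, h2⟩ := thetaRel_iff.1 h
  have e : ∀ x y z : A, (x ⊔ₜ y) ⊔ₜ (x ⊔ₜ z) = x ⊔ₜ (y ⊔ₜ z) := fun x y z =>
    (sup_sup_distrib_left (α := TruthLattice A) x y z).symm
  refine thetaRel_iff.2 ⟨?_, ?_⟩
  · rw [← tsup_ksup, e, h1]
  · rw [← tsup_ksup, e, h2]

end Theta

/-- The relation `θ_A`, given by `a θ_A b` iff `a ⊓ₜ b = a ⊔ₖ b`, as a congruence of `A_t`. -/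
def theta (A : Type u) [DistBilattice A] : LatticeCon (TruthLattice A) where
  r a b := ThetaRel (A := A) a b
  iseqv :=
    { refl := fun a => (bilat_tinf_self (A := A) a).trans (bilat_ksup_self (A := A) a).symm
      symm := thetaRel_symm
      trans := thetaRel_trans }
  inf {w x y z} h k := by
    refine thetaRel_trans (A := A) (b := DistPreBilattice.tinf (A := A) w z)
      (thetaRel_tinf (A := A) k w) ?_
    have := thetaRel_tinf (A := A) h z
    rwa [DistPreBilattice.tinf_comm (A := A) z w, DistPreBilattice.tinf_comm (A := A) z x] at this
  sup {w x y z} h k := by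
    refine thetaRel_trans (A := A) (b := DistPreBilattice.tsup (A := A) w z)
      (thetaRel_tsup (A := A) k w) ?_
    have := thetaRel_tsup (A := A) h z
    rwa [DistPreBilattice.tsup_comm (A := A) z w, DistPreBilattice.tsup_comm (A := A) z x] at this

/-- The map `[a] ↦ [h a]` from `A_t / θ_A` to `B_t / θ_B` induced by `h : A → B`. -/
def BilatHom.quotMap {A : Type u} {B : Type v} [DistBilattice A] [DistBilattice B]
    (h : BilatHom A B) : LatticeHom (LatQuot (theta A)) (LatQuot (theta B)) where
  toFun := Quotient.map (sa := (theta A).toSetoid) (sb := (theta B).toSetoid)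
    (fun a => h.toFun a) (by
      intro a b hab
      have hab' : DistPreBilattice.tinf (A := A) a b = DistPreBilattice.ksup (A := A) a b := hab
      exact (h.map_tinf a b).symm.trans ((congrArg h.toFun hab').trans (h.map_ksup a b)))
  map_sup' := by
    rintro ⟨a⟩ ⟨b⟩
    exact congrArg (Quotient.mk (theta B).toSetoid) (h.map_tsup a b)
  map_inf' := by
    rintro ⟨a⟩ ⟨b⟩
    exact congrArg (Quotient.mk (theta B).toSetoid) (h.map_tinf a b)

/-- The functor `V`: it takes `A` to `A_t / θ_A` and `h : A → B` to `[a] ↦ [h a]`. -/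
def Vu : DBu.{u} ⥤ Du.{u} where
  obj A := Du.of (LatQuot (theta A))
  map h := Du.ofHom (BilatHom.quotMap h)
  map_id A := by
    ext x
    obtain ⟨a⟩ := x
    rfl
  map_comp f g := by
    ext x
    obtain ⟨a⟩ := x
    rfl

/-! ## The product construction -/

/-- The underlying set `L × L` of the product bilattice `L ⊙ L`. -/
def Odot (L : Type u) : Type u := L × L

/-- The bilattice `L ⊙ L`: the truth lattice is `L × Lᵒᵈ`, the knowledge lattice is `L × L`, and
negation swaps the two coordinates. -/
instance instOdot (L : Type u) [DistribLattice L] : DistBilattice (Odot L) where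
  tsup a b := (a.1 ⊔ b.1, a.2 ⊓ b.2)
  tinf a b := (a.1 ⊓ b.1, a.2 ⊔ b.2)
  ksup a b := (a.1 ⊔ b.1, a.2 ⊔ b.2)
  kinf a b := (a.1 ⊓ b.1, a.2 ⊓ b.2)
  neg a := (a.2, a.1)
  tsup_comm _ _ := Prod.ext (sup_comm _ _) (inf_comm _ _)
  tsup_assoc _ _ _ := Prod.ext (sup_assoc _ _ _) (inf_assoc _ _ _)
  tinf_comm _ _ := Prod.ext (inf_comm _ _) (sup_comm _ _)
  tinf_assoc _ _ _ := Prod.ext (inf_assoc _ _ _) (sup_assoc _ _ _)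
  tsup_tinf_self _ _ := Prod.ext sup_inf_self inf_sup_self
  tinf_tsup_self _ _ := Prod.ext inf_sup_self sup_inf_self
  ksup_comm _ _ := Prod.ext (sup_comm _ _) (sup_comm _ _)
  ksup_assoc _ _ _ := Prod.ext (sup_assoc _ _ _) (sup_assoc _ _ _)
  kinf_comm _ _ := Prod.ext (inf_comm _ _) (inf_comm _ _)
  kinf_assoc _ _ _ := Prod.ext (inf_assoc _ _ _) (inf_assoc _ _ _)
  ksup_kinf_self _ _ := Prod.ext sup_inf_self sup_inf_self
  kinf_ksup_self _ _ := Prod.ext inf_sup_self inf_sup_self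
  tsup_tinf _ _ _ := Prod.ext (sup_inf_left _ _ _) (inf_sup_left _ _ _)
  tsup_ksup _ _ _ := Prod.ext (sup_sup_distrib_left _ _ _) (inf_sup_left _ _ _)
  tsup_kinf _ _ _ := Prod.ext (sup_inf_left _ _ _) (inf_inf_distrib_left _ _ _)
  tinf_tsup _ _ _ := Prod.ext (inf_sup_left _ _ _) (sup_inf_left _ _ _)
  tinf_ksup _ _ _ := Prod.ext (inf_sup_left _ _ _) (sup_sup_distrib_left _ _ _)
  tinf_kinf _ _ _ := Prod.ext (inf_inf_distrib_left _ _ _) (sup_inf_left _ _ _)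
  ksup_tsup _ _ _ := Prod.ext (sup_sup_distrib_left _ _ _) (sup_inf_left _ _ _)
  ksup_tinf _ _ _ := Prod.ext (sup_inf_left _ _ _) (sup_sup_distrib_left _ _ _)
  ksup_kinf _ _ _ := Prod.ext (sup_inf_left _ _ _) (sup_inf_left _ _ _)
  kinf_tsup _ _ _ := Prod.ext (inf_sup_left _ _ _) (inf_inf_distrib_left _ _ _)
  kinf_tinf _ _ _ := Prod.ext (inf_inf_distrib_left _ _ _) (inf_sup_left _ _ _)
  kinf_ksup _ _ _ := Prod.ext (inf_sup_left _ _ _) (inf_sup_left _ _ _)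
  neg_neg _ := rfl
  neg_tsup _ _ := rfl
  neg_tinf _ _ := rfl
  neg_ksup _ _ := rfl
  neg_kinf _ _ := rfl

instance (L : Type u) [Nonempty L] : Nonempty (Odot L) := inferInstanceAs (Nonempty (L × L))

/-- The functor `W`: it takes `L` to `L ⊙ L` and `g` to `(a, b) ↦ (g a, g b)`. -/
def Wu : Du.{u} ⥤ DBu.{u} where
  obj L := { carrier := Odot L.obj }
  map {L M} g :=
    { toFun := fun p => (Du.homOf g p.1, Du.homOf g p.2)
      map_tsup := fun _ _ => Prod.ext (map_sup (Du.homOf g) _ _) (map_inf (Du.homOf g) _ _)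
      map_tinf := fun _ _ => Prod.ext (map_inf (Du.homOf g) _ _) (map_sup (Du.homOf g) _ _)
      map_ksup := fun _ _ => Prod.ext (map_sup (Du.homOf g) _ _) (map_sup (Du.homOf g) _ _)
      map_kinf := fun _ _ => Prod.ext (map_inf (Du.homOf g) _ _) (map_inf (Du.homOf g) _ _)
      map_neg := fun _ => rfl }

end

/-! Everything rests on two facts: Priestley duality without bounds, and the product representation
of bilattices.

Modulo `θ_A` the two kinds of operation coincide: the distributive laws force `a ⊔ₖ b θ a ⊔ₜ b` and
`a ⊓ₖ b θ a ⊓ₜ b`. So `a ↦ [a]` takes knowledge and truth joins to joins and both meets to meets,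
and `a ↦ ([a], [¬a])` is a homomorphism into `L ⊙ L` with `L = A_t/θ_A`; negation swaps the two
classes. It is injective because `a θ b` and `¬a θ ¬b` together give `a ⊓ₜ b = a ⊔ₜ b`, and
surjective by an explicit term. Conversely, on `L ⊙ L` the congruence `θ` is equality of first
coordinates, so `V_u W_u` returns `L`; hence `L` is unique up to isomorphism.

The bilattice `4` is `2 ⊙ 2` in disguise, the pair being the first bit and the negated second bit. A
homomorphism `A → 4` commutes with negation, so its first bit determines it, and that bit is an
arbitrary lattice homomorphism `A_t/θ_A → 2`. This gives `D_u ≅ H_u V_u`. On the other side, a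
morphism of spaces into the alter ego is a pair of morphisms into the two-element chain, which gives
`E_u ≅ W_u K_u`.

Together with the Priestley isomorphism `1 ≅ K_u H_u` this yields `V_u ≅ K_u H_u V_u ≅ K_u D_u` and
`W_u ≅ W_u K_u H_u ≅ E_u H_u`. -/

noncomputable section

/-! ## Priestley duality for unbounded distributive lattices -/

section PriestleyDuality

variable {L : Type u} [DistribLattice L]

/-- The lattice homomorphism into `Bool` whose zero set is a given prime ideal. -/
def LatticeHom.ofPrimeIdeal (J : Order.Ideal L) (hJ : J.IsPrime) : LatticeHom L Bool where
  toFun a := by classical exact decide (a ∉ J)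
  map_sup' a b := by
    rw [Bool.eq_iff_iff]
    simp only [Order.Ideal.sup_mem_iff, Bool.max_eq_or, Bool.or_eq_true, decide_eq_true_eq]
    tauto
  map_inf' a b := by
    have h : a ⊓ b ∈ J ↔ a ∈ J ∨ b ∈ J :=
      ⟨hJ.mem_or_mem, fun h => h.elim (J.lower inf_le_left) (J.lower inf_le_right)⟩
    rw [Bool.eq_iff_iff]
    simp only [h, Bool.min_eq_and, Bool.and_eq_true, decide_eq_true_eq]
    tauto

/-- The prime ideal theorem, applied to the filter above `a` and the ideal below `b`, which are
disjoint exactly because `a ≰ b`. -/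
theorem LatticeHom.exists_bool_separating {a b : L} (hab : ¬ a ≤ b) :
    ∃ x : LatticeHom L Bool, x a = true ∧ x b = false := by
  classical
  have hdis : Disjoint ((Order.PFilter.principal a : Order.PFilter L) : Set L)
      (Order.Ideal.principal b : Set L) := by
    rw [Set.disjoint_left]
    intro c hac hcb
    exact hab (le_trans (Order.PFilter.mem_principal.1 hac) (Order.Ideal.mem_principal.1 hcb))
  obtain ⟨J, hJ, hbJ, haJ⟩ := DistribLattice.prime_ideal_of_disjoint_filter_ideal hdis
  have ha : a ∉ J := Set.disjoint_left.1 haJ (Order.PFilter.mem_principal.2 le_rfl)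
  have hb : b ∈ J := hbJ (Order.Ideal.mem_principal.2 le_rfl)
  exact ⟨LatticeHom.ofPrimeIdeal J hJ, by simpa [LatticeHom.ofPrimeIdeal] using ha,
    by simpa [LatticeHom.ofPrimeIdeal] using hb⟩

variable (L) in
/-- Evaluation of an element of a distributive lattice on the points of its Priestley dual. -/
def priestleyEval : LatticeHom L (P01Hom (LatticeHom L Bool) Bool) where
  toFun a :=
    { toFun := fun x => x a
      monotone' := fun _ _ h => h a
      map_top' := rfl
      map_bot' := rfl
      continuous_toFun := continuous_evalH L a }
  map_sup' a b := DFunLike.ext _ _ fun x => map_sup x a b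
  map_inf' a b := DFunLike.ext _ _ fun x => map_inf x a b

theorem priestleyEval_apply (a : L) (x : LatticeHom L Bool) : priestleyEval L a x = x a := rfl

theorem priestleyEval_injective : Function.Injective (priestleyEval L) := by
  have key : ∀ {a b : L}, priestleyEval L a = priestleyEval L b → a ≤ b := by
    intro a b h
    by_contra hab
    obtain ⟨x, ha, hb⟩ := LatticeHom.exists_bool_separating hab
    have := DFunLike.congr_fun h x
    rw [priestleyEval_apply, priestleyEval_apply, ha, hb] at this
    exact Bool.noConfusion this
  exact fun a b h => le_antisymm (key h) (key h.symm)

/-- The usual double compactness argument: `g⁻¹(1)` is a clopen up-set, and two directed covers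
single out an element `a` with `g⁻¹(1) = {x | x a = 1}`. As `L` may lack bounds, empty meets and
joins are not available; the conditions `g ⊥ = 0` and `g ⊤ = 1` take their place. -/
theorem priestleyEval_surjective : Function.Surjective (priestleyEval L) := by
  intro g
  have hg1 : g ⊤ = true := g.map_top'
  have hg0 : g ⊥ = false := g.map_bot'
  have hclosed : ∀ b, IsClosed {x | g x = b} := fun b =>
    (isClosed_discrete {b}).preimage g.continuous_toFun
  have hopen : ∀ (a : L) (b : Bool), IsOpen {x : LatticeHom L Bool | x a = b} := fun a b =>
    (isOpen_discrete {b}).preimage (continuous_evalH L a)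
  -- If no element separated `x` from `y`, then `x ≤ y` pointwise, against the monotonicity of `g`.
  have hsep : ∀ x y, g x = true → g y = false → ∃ a : L, x a = true ∧ y a = false := by
    intro x y hx hy
    by_contra! hn
    have hle : x ≤ y := fun a ha => by simpa using hn a ha
    have hle' : g x ≤ g y := g.monotone' hle
    rw [hx, hy] at hle'
    exact absurd hle' (by decide)
  -- For fixed `x`, the sets `{y | y a = 0}` with `x a = 1` cover the compact set `g⁻¹(0)`. Binary
  -- meets make the family directed, so one member suffices.
  have hinner : ∀ x, g x = true → ∃ a : L, x a = true ∧ ∀ y, g y = false → y a = false := by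
    intro x hx
    -- A directed cover needs a non-empty index set: the point `⊥` lies in `g⁻¹(0)`, so some `a₀`
    -- has `x a₀ = 1`.
    obtain ⟨a₀, ha₀, -⟩ := hsep x ⊥ hx hg0
    have : Nonempty {a : L // x a = true} := ⟨⟨a₀, ha₀⟩⟩
    obtain ⟨⟨a, ha⟩, hcov⟩ := (hclosed false).isCompact.elim_directed_cover
      (fun a : {a : L // x a = true} => {y : LatticeHom L Bool | y a = false})
      (fun a => hopen a false)
      (fun y hy => by
        obtain ⟨a, hxa, hya⟩ := hsep x y hx hy
        exact Set.mem_iUnion.2 ⟨⟨a, hxa⟩, hya⟩)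
      (fun a b => ⟨⟨a.1 ⊓ b.1, by rw [map_inf, a.2, b.2]; rfl⟩,
        fun y (hy : y a = false) => show y (a.1 ⊓ b.1) = false by rw [map_inf, hy]; rfl,
        fun y (hy : y b = false) => show y (a.1 ⊓ b.1) = false by
          rw [map_inf, hy]; exact inf_bot_eq _⟩)
    exact ⟨a, ha, fun y hy => hcov hy⟩
  -- The same precaution for the outer cover, now with `⊤` in `g⁻¹(1)`. That cover consists of the
  -- sets `{x | x a = 1}` for `a` vanishing on `g⁻¹(0)`, directed under binary joins.
  obtain ⟨a₀, -, ha₀⟩ := hinner ⊤ hg1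
  have : Nonempty {a : L // ∀ y, g y = false → y a = false} := ⟨⟨a₀, ha₀⟩⟩
  obtain ⟨⟨a, ha⟩, hcov⟩ := (hclosed true).isCompact.elim_directed_cover
    (fun a : {a : L // ∀ y, g y = false → y a = false} => {x : LatticeHom L Bool | x a = true})
    (fun a => hopen a true)
    (fun x hx => by
      obtain ⟨a, hxa, hya⟩ := hinner x hx
      exact Set.mem_iUnion.2 ⟨⟨a, hya⟩, hxa⟩)
    (fun a b => ⟨⟨a.1 ⊔ b.1, fun y hy => by rw [map_sup, a.2 y hy, b.2 y hy]; rfl⟩,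
      fun y (hy : y a = true) => show y (a.1 ⊔ b.1) = true by rw [map_sup, hy]; rfl,
      fun y (hy : y b = true) => show y (a.1 ⊔ b.1) = true by
        rw [map_sup, hy]; exact sup_top_eq _⟩)
  refine ⟨a, DFunLike.ext _ _ fun x => ?_⟩
  rw [priestleyEval_apply]
  cases hx : g x
  · exact ha x hx
  · exact hcov hx

end PriestleyDuality

/-! ## Isomorphisms from bijective homomorphisms -/

/-- A bijective lattice homomorphism is an isomorphism. -/
def Du.isoOfBijective {L M : Du.{u}} (f : LatticeHom L.obj M.obj) (hf : Function.Bijective f) :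
    L ≅ M :=
  let e := Equiv.ofBijective f hf
  { hom := ObjectProperty.homMk (DistLat.ofHom f)
    inv := ObjectProperty.homMk (DistLat.ofHom
      { toFun := e.symm
        map_sup' := fun a b => hf.1 <| by
          change e _ = f _
          rw [map_sup f]
          change e _ = e _ ⊔ e _
          simp only [Equiv.apply_symm_apply]
        map_inf' := fun a b => hf.1 <| by
          change e _ = f _
          rw [map_inf f]
          change e _ = e _ ⊓ e _
          simp only [Equiv.apply_symm_apply] })
    hom_inv_id := by
      ext x
      exact e.symm_apply_apply x
    inv_hom_id := by
      ext x
      exact e.apply_symm_apply x }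

/-- A bijective bilattice homomorphism is an isomorphism. -/
def DBu.isoOfBijective {A B : DBu.{u}} (f : BilatHom A B) (hf : Function.Bijective f.toFun) :
    A ≅ B :=
  let e := Equiv.ofBijective f.toFun hf
  { hom := f
    inv :=
      { toFun := e.symm
        map_tsup := fun a b => hf.1 <| by
          rw [f.map_tsup]
          change e _ = e _ ⊔ₜ e _
          simp only [Equiv.apply_symm_apply]
        map_tinf := fun a b => hf.1 <| by
          rw [f.map_tinf]
          change e _ = e _ ⊓ₜ e _
          simp only [Equiv.apply_symm_apply]
        map_ksup := fun a b => hf.1 <| by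
          rw [f.map_ksup]
          change e _ = e _ ⊔ₖ e _
          simp only [Equiv.apply_symm_apply]
        map_kinf := fun a b => hf.1 <| by
          rw [f.map_kinf]
          change e _ = e _ ⊓ₖ e _
          simp only [Equiv.apply_symm_apply]
        map_neg := fun a => hf.1 <| by
          rw [f.map_neg]
          change e _ = DistBilattice.neg (e _)
          simp only [Equiv.apply_symm_apply] }
    hom_inv_id := BilatHom.ext (funext fun x => e.symm_apply_apply x)
    inv_hom_id := BilatHom.ext (funext fun x => e.apply_symm_apply x) }

/-- Priestley duality: a distributive lattice is naturally isomorphic to its double dual. -/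
def priestleyIso : 𝟭 Du.{u} ≅ Hu.{u}.rightOp ⋙ Ku.{u} :=
  NatIso.ofComponents
    (fun L => Du.isoOfBijective (M := Ku.obj (op (Hu.obj (op L)))) (priestleyEval L.obj)
      ⟨priestleyEval_injective, priestleyEval_surjective⟩)
    (fun f => by
      ext a
      rfl)

/-! ## The product representation -/

section ProductRepresentation

open DistPreBilattice DistBilattice

/-! ### Truth and knowledge operations modulo `θ`, and the map `a ↦ ([a], [¬a])` -/

section Theta

variable {A : Type u} [DistBilattice A]

theorem bilat_kinf_self (a : A) : a ⊓ₖ a = a := by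
  have h := kinf_ksup_self a (a ⊓ₖ a)
  rwa [ksup_kinf_self] at h

theorem bilat_ksup_left_absorb (a b : A) : a ⊔ₖ b ⊔ₖ a = a ⊔ₖ b := by
  rw [ksup_comm, ← ksup_assoc, bilat_ksup_self]

theorem bilat_ksup_right_absorb (a b : A) : a ⊔ₖ b ⊔ₖ b = a ⊔ₖ b := by
  rw [ksup_assoc, bilat_ksup_self]

theorem bilat_tsup_left_absorb (a b : A) : a ⊔ₜ b ⊔ₜ a = a ⊔ₜ b := by
  rw [tsup_comm, ← tsup_assoc, bilat_tsup_self]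

theorem bilat_tsup_right_absorb (a b : A) : a ⊔ₜ b ⊔ₜ b = a ⊔ₜ b := by
  rw [tsup_assoc, bilat_tsup_self]

theorem bilat_tinf_left_absorb (a b : A) : a ⊓ₜ b ⊓ₜ a = a ⊓ₜ b := by
  rw [tinf_comm, ← tinf_assoc, bilat_tinf_self]

theorem bilat_tinf_right_absorb (a b : A) : a ⊓ₜ b ⊓ₜ b = a ⊓ₜ b := by
  rw [tinf_assoc, bilat_tinf_self]

/-- Distributivity and idempotence place `a ⊔ₖ b` below `a ⊔ₜ b` in the truth order and above it in
the knowledge order, so both sides of the defining equation of `θ` equal `a ⊔ₖ b`. -/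
theorem thetaRel_ksup_tsup (a b : A) : ThetaRel (a ⊔ₖ b) (a ⊔ₜ b) := by
  have ht : (a ⊔ₜ b) ⊔ₜ (a ⊔ₖ b) = a ⊔ₜ b := by
    rw [tsup_ksup, bilat_tsup_left_absorb, bilat_tsup_right_absorb, bilat_ksup_self]
  have hk : (a ⊔ₖ b) ⊔ₖ (a ⊔ₜ b) = a ⊔ₖ b := by
    rw [ksup_tsup, bilat_ksup_left_absorb, bilat_ksup_right_absorb, bilat_tsup_self]
  change (a ⊔ₖ b) ⊓ₜ (a ⊔ₜ b) = (a ⊔ₖ b) ⊔ₖ (a ⊔ₜ b)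
  rw [hk, ← ht, tsup_comm _ (a ⊔ₖ b), tinf_tsup_self]

/-- Here `a ⊓ₜ b` is below `a ⊓ₖ b` in the truth order and above it in the knowledge order, so both
sides of the defining equation equal `a ⊓ₜ b`. -/
theorem thetaRel_kinf_tinf (a b : A) : ThetaRel (a ⊓ₖ b) (a ⊓ₜ b) := by
  have ht : (a ⊓ₜ b) ⊓ₜ (a ⊓ₖ b) = a ⊓ₜ b := by
    rw [tinf_kinf, bilat_tinf_left_absorb, bilat_tinf_right_absorb, bilat_kinf_self]
  have hk : (a ⊓ₖ b) ⊔ₖ (a ⊓ₜ b) = a ⊓ₜ b := by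
    rw [ksup_tinf, ksup_comm _ a, ksup_kinf_self, kinf_comm, ksup_comm, ksup_kinf_self]
  change (a ⊓ₖ b) ⊓ₜ (a ⊓ₜ b) = (a ⊓ₖ b) ⊔ₖ (a ⊓ₜ b)
  rw [hk, tinf_comm, ht]

/-- An element is determined by its class and the class of its negation. -/
theorem eq_of_thetaRel_of_thetaRel_neg {a b : A} (h : ThetaRel a b)
    (hn : ThetaRel (neg a) (neg b)) : a = b := by
  have h' : a ⊓ₜ b = a ⊔ₖ b := h
  -- Negation turns the truth meet into a join and keeps the knowledge join; combined with `h'`, the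
  -- truth meet and join of `a` and `b` agree.
  have hn' : a ⊔ₜ b = a ⊔ₖ b := by
    have := congrArg neg (show neg a ⊓ₜ neg b = neg a ⊔ₖ neg b from hn)
    rwa [neg_tinf, neg_ksup, DistBilattice.neg_neg, DistBilattice.neg_neg] at this
  calc a = a ⊓ₜ (a ⊔ₜ b) := (tinf_tsup_self a b).symm
    _ = a ⊓ₜ b := by rw [hn', ← h', ← tinf_assoc, bilat_tinf_self]
    _ = b ⊓ₜ (a ⊔ₜ b) := by rw [hn', ← h', tinf_comm b, bilat_tinf_right_absorb]
    _ = b := by rw [tsup_comm, tinf_tsup_self]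

variable (A) in
/-- The lattice `A_t / θ_A`. -/
def ThetaQuot : Type u := LatQuot (theta A)

instance : DistribLattice (ThetaQuot A) := instQuotDistrib (theta A)

/-- The class of an element in `A_t / θ_A`. -/
def thetaMk (a : A) : ThetaQuot A := Quotient.mk (theta A).toSetoid a

theorem thetaMk_eq_iff {a b : A} : thetaMk a = thetaMk b ↔ ThetaRel a b :=
  ⟨fun h => Quotient.exact (s := (theta A).toSetoid) h,
    fun h => Quotient.sound (s := (theta A).toSetoid) h⟩

theorem thetaMk_surjective : Function.Surjective (thetaMk : A → ThetaQuot A) :=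
  Quotient.mk_surjective (s := (theta A).toSetoid)

theorem thetaMk_tsup (a b : A) : thetaMk (a ⊔ₜ b) = thetaMk a ⊔ thetaMk b := rfl

theorem thetaMk_tinf (a b : A) : thetaMk (a ⊓ₜ b) = thetaMk a ⊓ thetaMk b := rfl

theorem thetaMk_ksup (a b : A) : thetaMk (a ⊔ₖ b) = thetaMk a ⊔ thetaMk b :=
  thetaMk_eq_iff.2 (thetaRel_ksup_tsup a b)

theorem thetaMk_kinf (a b : A) : thetaMk (a ⊓ₖ b) = thetaMk a ⊓ thetaMk b :=
  thetaMk_eq_iff.2 (thetaRel_kinf_tinf a b)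

variable (A) in
/-- The map `a ↦ ([a], [¬ a])`. -/
def productHom : BilatHom A (Odot (ThetaQuot A)) where
  toFun a := (thetaMk a, thetaMk (neg a))
  map_tsup a b := Prod.ext rfl (congrArg thetaMk (neg_tsup a b))
  map_tinf a b := Prod.ext rfl (congrArg thetaMk (neg_tinf a b))
  map_ksup a b := Prod.ext (thetaMk_ksup a b)
    ((congrArg thetaMk (neg_ksup a b)).trans (thetaMk_ksup _ _))
  map_kinf a b := Prod.ext (thetaMk_kinf a b)
    ((congrArg thetaMk (neg_kinf a b)).trans (thetaMk_kinf _ _))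
  map_neg a := Prod.ext rfl (congrArg thetaMk (DistBilattice.neg_neg a))

theorem productHom_injective : Function.Injective (productHom A).toFun := fun _ _ h =>
  eq_of_thetaRel_of_thetaRel_neg (thetaMk_eq_iff.1 (congrArg Prod.fst h))
    (thetaMk_eq_iff.1 (congrArg Prod.snd h))

theorem productHom_surjective : Function.Surjective (productHom A).toFun := by
  rintro ⟨p, q⟩
  obtain ⟨a, rfl⟩ := thetaMk_surjective p
  obtain ⟨b', rfl⟩ := thetaMk_surjective q
  obtain ⟨b, rfl⟩ : ∃ b, neg b = b' := ⟨neg b', DistBilattice.neg_neg b'⟩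
  -- Write `a` as `(α, α')` and `b` as `(β, β')`; the target is `(α, β')`. The two factors represent
  -- `(α, α' ⊔ β')` and `(α ⊔ β, β')`, whose knowledge meet is the target. The element `a ⊔ₖ b`
  -- serves as a local substitute for a knowledge top.
  refine ⟨(a ⊓ₜ (a ⊔ₖ b)) ⊓ₖ (b ⊔ₜ (a ⊔ₖ b)), Prod.ext ?_ ?_⟩
  · change thetaMk _ = thetaMk a
    rw [thetaMk_kinf, thetaMk_tinf, thetaMk_tsup, thetaMk_ksup, inf_sup_self, inf_eq_left]
    exact le_sup_of_le_right le_sup_left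
  · change thetaMk (neg _) = thetaMk (neg b)
    rw [neg_kinf, neg_tinf, neg_tsup, neg_ksup, thetaMk_kinf, thetaMk_tinf, thetaMk_tsup,
      thetaMk_ksup, inf_eq_left.2 (le_sup_right : thetaMk (neg b) ≤ _), inf_eq_right]
    exact le_sup_of_le_right le_sup_right

end Theta

/-- The product representation `A ≅ L ⊙ L` for `L = A_t / θ_A`. -/
def productIso (A : DBu.{u}) : A ≅ Wu.obj (Vu.obj A) :=
  DBu.isoOfBijective (B := Wu.obj (Vu.obj A)) (productHom A.carrier)
    ⟨productHom_injective, productHom_surjective⟩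

/-! ### Recovering `L` from `L ⊙ L` -/

variable {L : Type u} [DistribLattice L]

/-- In `L ⊙ L` both `⊓ₜ` and `⊔ₖ` act as join on the second coordinate, so only the first imposes a
condition, namely that meet equals join. -/
theorem thetaRel_odot_iff {p q : Odot L} : ThetaRel p q ↔ p.1 = q.1 := by
  constructor
  · intro h
    exact inf_eq_sup.1 (congrArg Prod.fst (show p ⊓ₜ q = p ⊔ₖ q from h))
  · intro h
    refine Prod.ext (inf_eq_sup.2 h) rfl

variable (L) in
/-- The map `a ↦ [(a, a)]` from `L` to the quotient of the truth lattice of `L ⊙ L`. -/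
def diagonalHom : LatticeHom L (ThetaQuot (Odot L)) where
  toFun a := thetaMk (A := Odot L) (a, a)
  -- The truth join of `(a, a)` and `(b, b)` is `(a ⊔ b, a ⊓ b)`, which is off the diagonal in
  -- general but has the right first coordinate.
  map_sup' _ _ := thetaMk_eq_iff.2 (thetaRel_odot_iff.2 rfl)
  map_inf' _ _ := thetaMk_eq_iff.2 (thetaRel_odot_iff.2 rfl)

theorem diagonalHom_bijective : Function.Bijective (diagonalHom L) := by
  refine ⟨fun a b h => thetaRel_odot_iff.1 (thetaMk_eq_iff.1 h), fun x => ?_⟩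
  obtain ⟨p, rfl⟩ := thetaMk_surjective x
  exact ⟨p.1, thetaMk_eq_iff.2 (thetaRel_odot_iff.2 rfl)⟩

/-- `L` is recovered from `L ⊙ L` as the quotient by `θ`. -/
def diagonalIso (L : Du.{u}) : L ≅ Vu.obj (Wu.obj L) :=
  Du.isoOfBijective (M := Vu.obj (Wu.obj L)) (diagonalHom L.obj) diagonalHom_bijective

end ProductRepresentation

/-! ## The dual of a bilattice and the dual of its quotient lattice -/

section DualOfQuotient

open DistPreBilattice DistBilattice

theorem Four.le_iff_coord {a b : Four} : a ≤ b ↔ a.i ≤ b.i ∧ b.j ≤ a.j := by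
  obtain ⟨_ | _, _ | _⟩ := a <;> obtain ⟨_ | _, _ | _⟩ := b <;>
    simp [Four.le_iff, DistPreBilattice.kinf]

/-- The first bit is the projection of `Four` onto its quotient by `θ`; hence the first bit of a
homomorphism into `Four` factors through `A_t / θ_A`. -/
theorem Four.thetaRel_iff {a b : Four} : ThetaRel a b ↔ a.i = b.i := by
  obtain ⟨_ | _, _ | _⟩ := a <;> obtain ⟨_ | _, _ | _⟩ := b <;>
    simp [ThetaRel, DistPreBilattice.tinf, DistPreBilattice.ksup]

variable {A : Type u} [DistBilattice A]

/-- Negation of `Four` exchanges the bits and complements them, so the second bit carries no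
information beyond the first. -/
theorem BilatHom.apply_j (x : BilatHom A Four) (a : A) :
    (x.toFun a).j = !(x.toFun (neg a)).i := by
  rw [x.map_neg]
  exact (Bool.not_not _).symm

/-- The first coordinate of a homomorphism into `Four`, as a homomorphism on the quotient. -/
def BilatHom.fstCoord (x : BilatHom A Four) : LatticeHom (ThetaQuot A) Bool where
  toFun := Quotient.lift (s := (theta A).toSetoid) (fun a => (x.toFun a).i) fun a b hab =>
    Four.thetaRel_iff.1 ((x.map_tinf a b).symm.trans
      ((congrArg x.toFun (show ThetaRel (A := A) a b from hab)).trans (x.map_ksup a b)))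
  map_sup' := by
    rintro ⟨a⟩ ⟨b⟩
    exact congrArg Four.i (x.map_tsup a b)
  map_inf' := by
    rintro ⟨a⟩ ⟨b⟩
    exact congrArg Four.i (x.map_tinf a b)

/-- The homomorphism into `Four` with a given first coordinate. -/
def BilatHom.ofFstCoord (f : LatticeHom (ThetaQuot A) Bool) : BilatHom A Four where
  toFun a := ⟨f (thetaMk a), !f (thetaMk (neg a))⟩
  map_tsup a b := by
    refine Four.ext ?_ ?_
    · exact map_sup f (thetaMk a) (thetaMk b)
    · change (!f (thetaMk (neg (a ⊔ₜ b)))) = (!f (thetaMk (neg a)) || !f (thetaMk (neg b)))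
      rw [neg_tsup, thetaMk_tinf, map_inf]
      exact Bool.not_and _ _
  map_tinf a b := by
    refine Four.ext ?_ ?_
    · exact map_inf f (thetaMk a) (thetaMk b)
    · change (!f (thetaMk (neg (a ⊓ₜ b)))) = (!f (thetaMk (neg a)) && !f (thetaMk (neg b)))
      rw [neg_tinf, thetaMk_tsup, map_sup]
      exact Bool.not_or _ _
  map_ksup a b := by
    refine Four.ext ?_ ?_
    · change f (thetaMk (a ⊔ₖ b)) = _
      rw [thetaMk_ksup, map_sup]
      rfl
    · change (!f (thetaMk (neg (a ⊔ₖ b)))) = (!f (thetaMk (neg a)) && !f (thetaMk (neg b)))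
      rw [neg_ksup, thetaMk_ksup, map_sup]
      exact Bool.not_or _ _
  map_kinf a b := by
    refine Four.ext ?_ ?_
    · change f (thetaMk (a ⊓ₖ b)) = _
      rw [thetaMk_kinf, map_inf]
      rfl
    · change (!f (thetaMk (neg (a ⊓ₖ b)))) = (!f (thetaMk (neg a)) || !f (thetaMk (neg b)))
      rw [neg_kinf, thetaMk_kinf, map_inf]
      exact Bool.not_and _ _
  map_neg a := by
    refine Four.ext ?_ ?_
    · exact (Bool.not_not _).symm
    · change (!f (thetaMk (neg (neg a)))) = !f (thetaMk a)
      rw [DistBilattice.neg_neg]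

theorem BilatHom.ofFstCoord_fstCoord (x : BilatHom A Four) :
    BilatHom.ofFstCoord x.fstCoord = x :=
  BilatHom.ext (funext fun a => Four.ext rfl (x.apply_j a).symm)

theorem BilatHom.fstCoord_ofFstCoord (f : LatticeHom (ThetaQuot A) Bool) :
    (BilatHom.ofFstCoord f).fstCoord = f := by
  refine DFunLike.ext _ _ fun p => ?_
  obtain ⟨a, rfl⟩ := thetaMk_surjective p
  rfl

theorem BilatHom.continuous_fstCoord :
    Continuous (BilatHom.fstCoord : BilatHom A Four → LatticeHom (ThetaQuot A) Bool) := by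
  refine continuous_induced_rng.2 (continuous_pi fun p => ?_)
  obtain ⟨a, rfl⟩ := thetaMk_surjective p
  exact (continuous_of_discreteTopology (f := Four.i)).comp (continuous_evalD A a)

theorem BilatHom.continuous_ofFstCoord :
    Continuous (BilatHom.ofFstCoord : LatticeHom (ThetaQuot A) Bool → BilatHom A Four) := by
  refine continuous_induced_rng.2 (continuous_pi fun a => ?_)
  exact (continuous_of_discreteTopology (f := fun p : Bool × Bool => Four.mk p.1 !p.2)).comp
    ((continuous_evalH _ (thetaMk a)).prodMk (continuous_evalH _ (thetaMk (neg a))))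

variable (A) in
/-- The passage to the first coordinate as a morphism of doubly-pointed Priestley spaces. -/
def fstCoordHom : P01Hom (BilatHom A Four) (LatticeHom (ThetaQuot A) Bool) where
  toFun := BilatHom.fstCoord
  monotone' x y h p := by
    obtain ⟨a, rfl⟩ := thetaMk_surjective p
    exact (Four.le_iff_coord.1 (h a)).1
  map_top' := by
    refine DFunLike.ext _ _ fun p => ?_
    obtain ⟨a, rfl⟩ := thetaMk_surjective p
    rfl
  map_bot' := by
    refine DFunLike.ext _ _ fun p => ?_
    obtain ⟨a, rfl⟩ := thetaMk_surjective p
    rfl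
  continuous_toFun := BilatHom.continuous_fstCoord

variable (A) in
/-- The reconstruction from the first coordinate as a morphism of doubly-pointed Priestley
spaces. -/
def ofFstCoordHom : P01Hom (LatticeHom (ThetaQuot A) Bool) (BilatHom A Four) where
  toFun := BilatHom.ofFstCoord
  monotone' f g h a := by
    refine Four.le_iff_coord.2 ⟨h (thetaMk a), ?_⟩
    have := h (thetaMk (neg a))
    change (!g (thetaMk (neg a))) ≤ !f (thetaMk (neg a))
    change f (thetaMk (neg a)) ≤ g (thetaMk (neg a)) at this
    revert this
    cases f (thetaMk (neg a)) <;> cases g (thetaMk (neg a)) <;> decide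
  map_top' := rfl
  map_bot' := rfl
  continuous_toFun := BilatHom.continuous_ofFstCoord

/-- The natural dual of a bilattice is the Priestley dual of its quotient lattice. -/
def dualIso (A : DBu.{u}) : DuDB.obj (op A) ≅ Hu.obj (op (Vu.obj A)) where
  hom := fstCoordHom A.carrier
  inv := ofFstCoordHom A.carrier
  hom_inv_id := DFunLike.ext (F := P01Hom _ _) _ _ fun x => BilatHom.ofFstCoord_fstCoord x
  inv_hom_id := DFunLike.ext (F := P01Hom _ _) _ _ fun f => BilatHom.fstCoord_ofFstCoord f

/-- The duals of `A` and of `A_t / θ_A` agree, naturally in `A`. -/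
def dualNatIso : DuDB.{u}.rightOp ≅ Vu.{u} ⋙ Hu.{u}.rightOp :=
  NatIso.ofComponents (fun A => (dualIso A).symm.op) (by
    intro A B h
    -- Without the opposites, the square compares two homomorphisms built by `BilatHom.ofFstCoord`.
    -- Their first bits agree by definition; the second bits agree because `h` commutes with
    -- negation.
    apply Quiver.Hom.unop_inj
    refine DFunLike.ext (F := P01Hom (LatticeHom (ThetaQuot B.carrier) Bool)
      (BilatHom A.carrier Four)) _ _ fun f => ?_
    exact BilatHom.ext (funext fun a => Four.ext rfl
      (congrArg (fun b => !f (thetaMk b)) (BilatHom.map_neg h a).symm)))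

end DualOfQuotient

/-! ## Bilattices of morphisms into `Four` as products -/

section DualOfSpace

variable {X : Type u} [TopologicalSpace X] [PartialOrder X] [BoundedOrder X]

/-- The first coordinate `Four → Bool`. -/
def P01Hom.fourFst : P01Hom Four Bool where
  toFun a := a.i
  monotone' _ _ h := (Four.le_iff_coord.1 h).1
  map_top' := rfl
  map_bot' := rfl
  continuous_toFun := continuous_of_discreteTopology

/-- The negated second coordinate `Four → Bool`. -/
def P01Hom.fourSnd : P01Hom Four Bool where
  toFun a := !a.j
  monotone' a b h := by
    have := (Four.le_iff_coord.1 h).2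
    revert this
    change b.j ≤ a.j → (!a.j) ≤ !b.j
    cases a.j <;> cases b.j <;> decide
  map_top' := rfl
  map_bot' := rfl
  continuous_toFun := continuous_of_discreteTopology

variable (X) in
/-- A morphism into `Four` is a pair of morphisms into `Bool`. -/
def coordsHom : BilatHom (P01Hom X Four) (Odot (P01Hom X Bool)) where
  toFun f := (P01Hom.fourFst.comp f, P01Hom.fourSnd.comp f)
  map_tsup f g := Prod.ext rfl (DFunLike.ext _ _ fun x => Bool.not_or (f x).j (g x).j)
  map_tinf f g := Prod.ext rfl (DFunLike.ext _ _ fun x => Bool.not_and (f x).j (g x).j)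
  map_ksup f g := Prod.ext rfl (DFunLike.ext _ _ fun x => Bool.not_and (f x).j (g x).j)
  map_kinf f g := Prod.ext rfl (DFunLike.ext _ _ fun x => Bool.not_or (f x).j (g x).j)
  map_neg f := Prod.ext rfl (DFunLike.ext _ _ fun x => Bool.not_not (f x).i)

/-- The knowledge order of `Four` is the product order of the first bit and the negated second bit,
so a pair of morphisms into `Bool` reassembles to a monotone map; continuity and preservation of the
distinguished points are coordinatewise too. -/
theorem coordsHom_bijective : Function.Bijective (coordsHom X).toFun := by
  constructor
  · intro f g h
    refine DFunLike.ext _ _ fun x => Four.ext ?_ ?_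
    · exact DFunLike.congr_fun (congrArg Prod.fst h) x
    · exact Bool.not_inj (DFunLike.congr_fun (congrArg Prod.snd h) x)
  · rintro ⟨f, g⟩
    let k : P01Hom X Four :=
      { toFun := fun x => ⟨f x, !g x⟩
        monotone' := fun x y h => by
          refine Four.le_iff_coord.2 ⟨f.monotone' h, ?_⟩
          have hg : g x ≤ g y := g.monotone' h
          revert hg
          change g x ≤ g y → (!g y) ≤ !g x
          cases g x <;> cases g y <;> decide
        map_top' := Four.ext f.map_top' (congrArg not g.map_top')
        map_bot' := Four.ext f.map_bot' (congrArg not g.map_bot')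
        continuous_toFun := (continuous_of_discreteTopology
          (f := fun p : Bool × Bool => Four.mk p.1 !p.2)).comp
          (f.continuous_toFun.prodMk g.continuous_toFun) }
    exact ⟨k, Prod.ext rfl (DFunLike.ext _ _ fun x => Bool.not_not (g x))⟩

/-- `E_u` is the product construction applied to `K_u`. -/
def coordsIso : Ku.{u} ⋙ Wu.{u} ≅ EuDB.{u} :=
  NatIso.ofComponents
    (fun X => (DBu.isoOfBijective (A := EuDB.obj X) (B := Wu.obj (Ku.obj X))
      (coordsHom X.unop.carrier) coordsHom_bijective).symm)
    (fun {X Y} φ => by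
      -- The inverses are moved across the square, since naturality of the coordinate maps
      -- themselves holds by definition.
      rw [Iso.symm_hom, Iso.symm_hom, Iso.comp_inv_eq, Category.assoc, Iso.eq_inv_comp]
      rfl)

end DualOfSpace

/-- `V_u` is naturally isomorphic to `K_u D_u`. -/
def VuIso : Vu.{u} ≅ DuDB.{u}.rightOp ⋙ Ku.{u} :=
  -- Insert the double dual after `Vu`, then replace `Hu` of the quotient lattice by `DuDB`.
  Vu.rightUnitor.symm ≪≫ Functor.isoWhiskerLeft Vu priestleyIso ≪≫
    (Functor.associator _ _ _).symm ≪≫ Functor.isoWhiskerRight dualNatIso.symm Ku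

/-- `W_u` is naturally isomorphic to `E_u H_u`. -/
def WuIso : Wu.{u} ≅ Hu.{u}.rightOp ⋙ EuDB.{u} :=
  -- Insert the double dual before `Wu`, then replace `Wu` after `Ku` by `EuDB`.
  Wu.leftUnitor.symm ≪≫ Functor.isoWhiskerRight priestleyIso Wu ≪≫
    Functor.associator _ _ _ ≪≫ Functor.isoWhiskerLeft Hu.rightOp coordsIso

end

theorem theorem7p5 :
    Nonempty (Vu.{u} ≅ DuDB.{u}.rightOp ⋙ Ku.{u}) ∧
    Nonempty (Wu.{u} ≅ Hu.{u}.rightOp ⋙ EuDB.{u}) ∧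
    (∀ A : DBu.{u}, Nonempty (A ≅ Wu.obj (Vu.obj A))) ∧
    (∀ (A : DBu.{u}) (L : Du.{u}), Nonempty (A ≅ Wu.obj L) → Nonempty (L ≅ Vu.obj A)) := by
  refine ⟨⟨VuIso⟩, ⟨WuIso⟩, fun A => ⟨productIso A⟩, ?_⟩
  rintro A L ⟨e⟩
  -- `L ≅ V_u (W_u L) ≅ V_u A`, the second step because functors preserve isomorphisms.
  exact ⟨diagonalIso L ≪≫ Vu.mapIso e.symm⟩
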